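/- **Setting.** A (shotgun cellular) system with intensity measure $\Lambda$ on $\mathbb{R}^l$ consists of random base stations $X_1,X_2,\dots$ forming a Poisson point process with intensity measure $\Lambda$ (the number of points in a measurable set $A$ is Poisson with mean $\Lambda(A)$, a.s. infinite if $\Lambda(A)=\infty$, and the numbers of points in disjoint sets are independent), indexed as an infinite sequence so that $R_k=|X_k|$ satisfies $R_1\le R_2\le\cdots$ almost surely. (For the systems below, such an indexing exists exactly when $\Lambda$ has infinite total mass and is finite on bounded sets; only such systems are considered.) The homogeneous $l$-D system with density $\lambda_0$ has $\Lambda(dx)=\lambda_0\,dx$ on $\mathbb{R}^l$; the 1-D system with density function $\lambda(r)$, $r\ge 0$, has $\Lambda(dr)=\lambda(r)\,dr$ on $[0,\infty)$. For a path-loss exponent $\varepsilon>0$ the carrier-to-interference ratio at the origin is $$\frac{C}{I}=\frac{R_1^{-\varepsilon}}{\sum_{k\ge 2}R_k^{-\varepsilon}}$$ (equal to $0$ if the sum diverges), and we write $\frac CI\big|_{\Lambda}$ or $\frac CI\big|_{\lambda(r)}$ for it in the respective system. For random variables, $X\le_{\rm st}Y$ means $\mathbb{P}(X>x)\le\mathbb{P}(Y>x)$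 for all real $x$. **Statement.** Let $\varepsilon>0$, $\lambda_0>0$, $b_1=2$, $b_2=2\pi$, $b_3=4\pi$, and $\lambda_l(r)=\lambda_0 b_l r^{l-1}$ for $r\ge 0$ and $l\in\{1,2,3\}$. 1. For $l\in\{1,2,3\}$, the distances $R_k=|X_k|$ of the base stations of a homogeneous $l$-D system with density $\lambda_0$ form a 1-D system with density function $\lambda_l(r)$. 2. For $l\in\{1,2,3\}$, if $\beta(r)>0$ is non-increasing on $(0,\infty)$, then $\frac CI\big|_{\lambda_l(r)}\le_{\rm st}\frac CI\big|_{\beta(r)\lambda_l(r)}$. 3. For $l\in\{1,2,3\}$, if $\beta(r)>0$ is non-decreasing on $(0,\infty)$, then $\frac CI\big|_{\beta(r)\lambda_l(r)}\le_{\rm st}\frac CI\big|_{\lambda_l(r)}$. 4. Consequently $\frac CI\big|_{\lambda_1(r)}\ge_{\rm st}\frac CI\big|_{\lambda_2(r)}\ge_{\rm st}\frac CI\big|_{\lambda_3(r)}$, and likewise the ratio $\frac CI$ of the homogeneous 1-D system with density $\lambda_0$ is stochastically at least that of the homogeneous 2-D system with density $\lambda_0$, which is stochastically at least that of the homogeneous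 3-D system with density $\lambda_0$. -/

import Mathlib

open MeasureTheory ProbabilityTheory
open scoped ENNReal

universe u v

namespace Shotgun

/-- The number (with multiplicity, possibly infinite) of points of the sequence `x` that lie in
the set `A`. -/
noncomputable def count {E : Type*} (x : ℕ → E) (A : Set E) : ℕ∞ :=
  {k : ℕ | x k ∈ A}.encard

/-- `X 0, X 1, X 2, …` are the points of a Poisson point process on `E` with intensity measure `Λ`
(the base stations of a shotgun cellular system), listed in ascending order of their distance to
the mobile station, which is at the origin. The number of points in a measurable set `A` is Poisson
distributed with mean `Λ A` (it is a.s. infinite if `Λ A = ∞`), and the numbers of points in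
disjoint sets are independent. -/
structure IsSCS {E Ω : Type*} [NormedAddCommGroup E] [MeasurableSpace E] [MeasurableSpace Ω]
    (Λ : Measure E) (P : Measure Ω) (X : ℕ → Ω → E) : Prop where
  measurable : ∀ k, Measurable (X k)
  ordered : ∀ᵐ ω ∂P, Monotone fun k => ‖X k ω‖
  poisson : ∀ A : Set E, MeasurableSet A → Λ A ≠ ∞ → ∀ n : ℕ,
    P {ω | count (fun k => X k ω) A = n} = poissonMeasure (Λ A).toNNReal {n}
  infinite : ∀ A : Set E, MeasurableSet A → Λ A = ∞ → ∀ᵐ ω ∂P, count (fun k => X k ω) A = ⊤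
  indep : ∀ (m : ℕ) (A : Fin m → Set E), (∀ i, MeasurableSet (A i)) →
    Pairwise (Function.onFun Disjoint A) →
    iIndepFun (fun (i : Fin m) (ω : Ω) => count (fun k => X k ω) (A i)) P

/-- The intensity measure on `ℝ` of a 1-D system with density function `lam r`, `r ≥ 0`, where `r`
is the distance to the mobile station. -/
noncomputable def radialIntensity (lam : ℝ → ℝ) : Measure ℝ :=
  (volume.restrict (Set.Ici 0)).withDensity fun r => ENNReal.ofReal (lam r)

/-- The intensity measure of the homogeneous `l`-dimensional system with density `lam0`. -/
noncomputable def homogeneousIntensity (l : ℕ) (lam0 : ℝ) : Measure (EuclideanSpace ℝ (Fin l)) :=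
  ENNReal.ofReal lam0 • volume

/-- The constants `b₁ = 2`, `b₂ = 2π`, `b₃ = 4π`; other indices are not used. -/
noncomputable def b (l : ℕ) : ℝ :=
  if l = 1 then 2 else if l = 2 then 2 * Real.pi else if l = 3 then 4 * Real.pi else 0

/-- The 1-D density function `lam0 * b_l * r ^ (l - 1)`, used for `l = 1, 2, 3`. -/
noncomputable def homogeneousDensity (l : ℕ) (lam0 : ℝ) (r : ℝ) : ℝ :=
  lam0 * b l * r ^ (l - 1)

/-- The carrier-to-interference ratio `‖x₀‖^(-ε) / ∑_{k ≥ 1} ‖x_k‖^(-ε)` at the origin, for base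
stations `x₀, x₁, …` in ascending order of distance and path-loss exponent `ε`. It is `0` if the
interference is infinite. -/
noncomputable def carrierToInterference {E : Type*} [NormedAddCommGroup E] (ε : ℝ) (x : ℕ → E) :
    ℝ≥0∞ :=
  ‖x 0‖ₑ ^ (-ε) / ∑' k : ℕ, ‖x (k + 1)‖ₑ ^ (-ε)

/-- `X ≤ Y` in the usual stochastic order, for extended real random variables `X` under `P` and
`Y` under `Q`: `P (X > x) ≤ Q (Y > x)` for all real `x`. -/
def StLE {Ω Ω' : Type*} [MeasurableSpace Ω] [MeasurableSpace Ω'] (P : Measure Ω) (X : Ω → EReal)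
    (Q : Measure Ω') (Y : Ω' → EReal) : Prop :=
  ∀ x : ℝ, P {ω | (x : EReal) < X ω} ≤ Q {ω | (x : EReal) < Y ω}

/-- The carrier-to-interference ratio of a system with intensity measure `Λ` is stochastically at
most that of a system with intensity measure `Λ'`: this holds for any random base stations that
realize the two systems, on any probability spaces. -/
def CIOrder {E E' : Type} [NormedAddCommGroup E] [MeasurableSpace E]
    [NormedAddCommGroup E'] [MeasurableSpace E'] (ε : ℝ) (Λ : Measure E) (Λ' : Measure E') : Prop :=
  ∀ (Ω : Type u) (Ω' : Type v) [MeasurableSpace Ω] [MeasurableSpace Ω']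
    (P : Measure Ω) (P' : Measure Ω') [IsProbabilityMeasure P] [IsProbabilityMeasure P']
    (X : ℕ → Ω → E) (X' : ℕ → Ω' → E'), IsSCS Λ P X → IsSCS Λ' P' X' →
    StLE P (fun ω => (carrierToInterference ε (fun k => X k ω) : EReal))
      P' (fun ω => (carrierToInterference ε (fun k => X' k ω) : EReal))

end Shotgun

/-! The proof is a coupling. Let `μ` be the intensity with density `β(r) λ_l(r)`. The unmodulated
system has cumulated intensity `c r ^ l` with `c = λ₀ b_l / l`, and the increasing map `T` defined
by `c T(s) ^ l = μ [0, s]` pushes `μ` forward to it (`map_transport`). By the mapping theorem,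
moving each point of a modulated system by `T` realizes the unmodulated system on the same
probability space (`IsSCS.transport`).

The ratio `C/I` depends only on the relative distances `R_k / R_1` and increases with them
(`carrierToInterference_le`). If `β` is non-increasing, so is its `λ_l`-weighted mean over `[0, s]`.
That mean is `(T(s) / s) ^ l`, so `T` shrinks relative distances and `C/I` of the image is at most
that of the original, almost surely. For non-decreasing `β` the inequality reverses.

The statement concerns arbitrary realizations, so uniqueness in law is needed: the intensity
determines the joint law of the ordered distances (`IsSCS.map_norm_eq`), hence that of `C/I`. The
comparison of dimensions is the case `β(r) = b_l / (b_{l+1} r)`, which turns `λ_{l+1}` into `λ_l`;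
taking norms transfers it to `ℝ^l`. -/

namespace Shotgun

/-! ### Point counts and common refinements of finite families. -/

section Counting

variable {E Ω : Type*} [MeasurableSpace Ω]

theorem measurable_count [MeasurableSpace E] {X : ℕ → Ω → E} (hX : ∀ k, Measurable (X k))
    {A : Set E} (hA : MeasurableSet A) : Measurable fun ω => count (fun k => X k ω) A := by
  have h : Measurable fun ω => {k : ℕ | X k ω ∈ A} := by
    rw [measurable_set_iff]
    intro k
    exact measurable_mem.mpr (hX k hA) |>.comp measurable_id
  exact measurable_encard.comp h

/-- The common refinement of a family of sets: the points whose set of indices of members of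
the family is exactly `S`. -/
def atomOf {ι : Type*} (B : ι → Set E) (S : Finset ι) : Set E := {x | ∀ i, x ∈ B i ↔ i ∈ S}

theorem pairwise_disjoint_atomOf {ι : Type*} (B : ι → Set E) :
    Pairwise (Function.onFun Disjoint (atomOf B)) := by
  intro S T hST
  rw [Function.onFun, Set.disjoint_left]
  intro x hS hT
  exact hST (Finset.ext fun i => (hS i).symm.trans (hT i))

theorem measurableSet_atomOf {ι : Type*} [Finite ι] [MeasurableSpace E] {B : ι → Set E}
    (hB : ∀ i, MeasurableSet (B i)) (S : Finset ι) : MeasurableSet (atomOf B S) := by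
  have : atomOf B S = ⋂ i, {x | x ∈ B i ↔ i ∈ S} := by
    ext x; simp [atomOf]
  rw [this]
  refine MeasurableSet.iInter fun i => ?_
  by_cases hi : i ∈ S
  · simpa [hi] using hB i
  · simp only [hi, iff_false]
    exact (hB i).compl

/-- Each member of the family is the disjoint union of the atoms whose index set contains it.
Overlapping sets, such as nested balls, are thereby reduced to disjoint ones, where independence is
available. -/
theorem count_eq_sum_atomOf {ι : Type*} [Fintype ι] [DecidableEq ι] (x : ℕ → E) (B : ι → Set E)
    (i : ι) : count x (B i) = ∑ S : Finset ι, if i ∈ S then count x (atomOf B S) else 0 := by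
  classical
  have h : {k | x k ∈ B i} = ⋃ S : Finset ι, {k | i ∈ S ∧ x k ∈ atomOf B S} := by
    ext k
    simp only [Set.mem_ofPred_eq, Set.mem_iUnion]
    constructor
    · intro hk
      exact ⟨Finset.univ.filter fun j => x k ∈ B j, by simpa using hk, fun j => by simp⟩
    · rintro ⟨S, hi, hS⟩
      exact (hS i).2 hi
  have hd : Pairwise (Function.onFun Disjoint fun S : Finset ι => {k | i ∈ S ∧ x k ∈ atomOf B S}) := by
    intro S T hST
    rw [Function.onFun, Set.disjoint_left]
    intro k hS hT
    exact Set.disjoint_left.1 (pairwise_disjoint_atomOf B hST) hS.2 hT.2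
  rw [count, h, Set.encard_iUnion_of_finite hd, finsum_eq_sum_of_fintype]
  refine Finset.sum_congr rfl fun S _ => ?_
  split_ifs with hi
  · simp [count, hi]
  · simp [hi]

end Counting

/-! ### The intensity determines the law of the ordered distances. -/

section Law

variable {E Ω Ω' : Type*} [NormedAddCommGroup E] [MeasurableSpace E]
  [MeasurableSpace Ω] [MeasurableSpace Ω'] {Λ : Measure E} {P : Measure Ω} {Q : Measure Ω'}
  [IsProbabilityMeasure P] [IsProbabilityMeasure Q] {X : ℕ → Ω → E} {Y : ℕ → Ω' → E}

theorem IsSCS.map_count_eq (hX : IsSCS Λ P X) (hY : IsSCS Λ Q Y) {A : Set E}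
    (hA : MeasurableSet A) :
    P.map (fun ω => count (fun k => X k ω) A) = Q.map (fun ω => count (fun k => Y k ω) A) := by
  have mX := measurable_count hX.measurable hA
  have mY := measurable_count hY.measurable hA
  by_cases h : Λ A = ∞
  · have h1 : P.map (fun ω => count (fun k => X k ω) A) = P.map (fun _ => (⊤ : ℕ∞)) :=
      Measure.map_congr (hX.infinite A hA h)
    have h2 : Q.map (fun ω => count (fun k => Y k ω) A) = Q.map (fun _ => (⊤ : ℕ∞)) :=
      Measure.map_congr (hY.infinite A hA h)
    rw [h1, h2]; simp
  · have key : ∀ n : ℕ, P.map (fun ω => count (fun k => X k ω) A) {(n : ℕ∞)} =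
        Q.map (fun ω => count (fun k => Y k ω) A) {(n : ℕ∞)} := by
      intro n
      rw [Measure.map_apply mX (measurableSet_singleton _),
        Measure.map_apply mY (measurableSet_singleton _)]
      exact (hX.poisson A hA h n).trans (hY.poisson A hA h n).symm
    have := Measure.isProbabilityMeasure_map (μ := P) mX.aemeasurable
    have := Measure.isProbabilityMeasure_map (μ := Q) mY.aemeasurable
    have hr : MeasurableSet (Set.range ((↑) : ℕ → ℕ∞)) := .of_discrete
    have hrange : P.map (fun ω => count (fun k => X k ω) A) (Set.range ((↑) : ℕ → ℕ∞)) =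
        Q.map (fun ω => count (fun k => Y k ω) A) (Set.range ((↑) : ℕ → ℕ∞)) := by
      rw [← Set.iUnion_singleton_eq_range, measure_iUnion _ fun _ => .of_discrete,
        measure_iUnion _ fun _ => .of_discrete]
      · simp_rw [key]
      all_goals
        intro i j hij
        simpa [Function.onFun] using hij
    refine Measure.ext_of_singleton fun a => ?_
    cases a with
    | coe n => exact key n
    | top =>
      -- The Poisson axiom covers finite values only; the mass at `⊤` is what they leave of total
      -- mass one.
      have : ({⊤} : Set ℕ∞) = (Set.range ((↑) : ℕ → ℕ∞))ᶜ := by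
        ext a; cases a <;> simp
      rw [this, prob_compl_eq_one_sub hr, prob_compl_eq_one_sub hr, hrange]

/-- The counts of the atoms are independent with prescribed marginals, so their joint law is a fixed
product measure; the counts of the `B i` are one measurable function of them. -/
theorem IsSCS.map_counts_eq (hX : IsSCS Λ P X) (hY : IsSCS Λ Q Y) {ι : Type*} [Fintype ι]
    {B : ι → Set E} (hB : ∀ i, MeasurableSet (B i)) :
    P.map (fun ω i => count (fun k => X k ω) (B i)) =
      Q.map (fun ω i => count (fun k => Y k ω) (B i)) := by
  classical
  let e := Fintype.equivFin (Finset ι)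
  have hmeas := measurableSet_atomOf hB
  have hdisj : Pairwise (Function.onFun Disjoint fun j => atomOf B (e.symm j)) := fun i j hij =>
    pairwise_disjoint_atomOf B (e.symm.injective.ne hij)
  have iX : iIndepFun (fun S ω => count (fun k => X k ω) (atomOf B S)) P := by
    simpa using (hX.indep _ (fun j => atomOf B (e.symm j)) (fun _ => hmeas _) hdisj).precomp
      e.injective
  have iY : iIndepFun (fun S ω => count (fun k => Y k ω) (atomOf B S)) Q := by
    simpa using (hY.indep _ (fun j => atomOf B (e.symm j)) (fun _ => hmeas _) hdisj).precomp
      e.injective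
  have mX := fun S => measurable_count hX.measurable (hmeas S)
  have mY := fun S => measurable_count hY.measurable (hmeas S)
  rw [iIndepFun_iff_map_fun_eq_pi_map fun S => (mX S).aemeasurable] at iX
  rw [iIndepFun_iff_map_fun_eq_pi_map fun S => (mY S).aemeasurable] at iY
  have h : P.map (fun ω S => count (fun k => X k ω) (atomOf B S)) =
      Q.map (fun ω S => count (fun k => Y k ω) (atomOf B S)) := by
    rw [iX, iY]
    congr 1
    funext S
    exact hX.map_count_eq hY (hmeas S)
  let f : (Finset ι → ℕ∞) → ι → ℕ∞ := fun c i => ∑ S : Finset ι, if i ∈ S then c S else 0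
  have hf : Measurable f := by
    refine measurable_pi_iff.2 fun i => Finset.measurable_sum _ fun S _ => ?_
    split_ifs
    · exact measurable_pi_apply S
    · exact measurable_const
  have h' := congrArg (Measure.map f) h
  rw [Measure.map_map hf (measurable_pi_iff.2 mX),
    Measure.map_map hf (measurable_pi_iff.2 mY)] at h'
  convert h' using 2 <;>
  · funext ω i
    exact count_eq_sum_atomOf _ B i

/-- In a monotone sequence, the `k`-th term is at most `a` iff more than `k` terms are. -/
theorem lt_count_iff_of_monotone {r : ℕ → ℝ} (hr : Monotone r) (k : ℕ) (a : ℝ) :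
    (k : ℕ∞) < {j | r j ≤ a}.encard ↔ r k ≤ a := by
  constructor
  · intro h
    by_contra! hk
    have hsub : {j | r j ≤ a} ⊆ (Finset.range k : Set ℕ) := by
      intro j hj
      simp only [Finset.coe_range, Set.mem_Iio]
      by_contra! hkj
      exact absurd (hk.trans_le (hr hkj)) (not_lt.2 hj)
    have := Set.encard_le_encard hsub
    rw [Set.encard_coe_eq_coe_finsetCard, Finset.card_range] at this
    exact absurd h (not_lt.2 this)
  · intro h
    have hsub : (Finset.range (k + 1) : Set ℕ) ⊆ {j | r j ≤ a} := by
      intro j hj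
      simp only [Finset.coe_range, Set.mem_Iio] at hj
      exact (hr (Nat.lt_succ_iff.1 hj)).trans h
    have := Set.encard_le_encard hsub
    rw [Set.encard_coe_eq_coe_finsetCard, Finset.card_range] at this
    refine lt_of_lt_of_le ?_ this
    exact_mod_cast Nat.lt_succ_self k

/-- Two measures on sequences agree if they agree on finite intersections of half-lines. -/
theorem ext_of_forall_Iic {μ ν : Measure (ℕ → ℝ)} [IsProbabilityMeasure μ] [IsProbabilityMeasure ν]
    (h : ∀ (t : Finset ℕ) (a : ℕ → ℝ), μ {x | ∀ i ∈ t, x i ≤ a i} = ν {x | ∀ i ∈ t, x i ≤ a i}) :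
    μ = ν := by
  let C : ℕ → Set (Set (ℕ → ℝ)) := fun i => (fun s => Function.eval i ⁻¹' s) '' Set.range Set.Iic
  have hC : ∀ i, IsPiSystem (C i) := by
    rintro i _ ⟨_, ⟨a, rfl⟩, rfl⟩ _ ⟨_, ⟨b, rfl⟩, rfl⟩ -
    exact ⟨_, ⟨min a b, rfl⟩, by ext x; simp⟩
  refine ext_of_generate_finite (piiUnionInter C Set.univ) ?_
    (isPiSystem_piiUnionInter C hC _) ?_ (by simp)
  · refine le_antisymm ?_ ?_
    · refine iSup_le fun i => ?_
      rw [BorelSpace.measurable_eq (α := ℝ), borel_eq_generateFrom_Iic,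
        MeasurableSpace.comap_generateFrom]
      exact MeasurableSpace.generateFrom_mono (subset_piiUnionInter (π := C) (Set.mem_univ i))
    · refine generateFrom_piiUnionInter_le C (fun i => ?_) _
      refine MeasurableSpace.generateFrom_le ?_
      rintro _ ⟨_, ⟨a, rfl⟩, rfl⟩
      exact measurable_pi_apply i measurableSet_Iic
  · rintro _ ⟨t, -, f, hf, rfl⟩
    have : ∀ i, ∃ a : ℝ, i ∈ t → f i = Function.eval i ⁻¹' Set.Iic a := by
      intro i
      by_cases hi : i ∈ t
      · obtain ⟨_, ⟨a, rfl⟩, h⟩ := hf i hi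
        exact ⟨a, fun _ => h.symm⟩
      · exact ⟨0, fun h => absurd h hi⟩
    choose a ha using this
    have hs : ⋂ x ∈ t, f x = {x | ∀ i ∈ t, x i ≤ a i} := by
      ext x
      simp only [Set.mem_iInter, Set.mem_ofPred_eq]
      exact forall₂_congr fun i hi => by rw [ha i hi]; rfl
    rw [hs]
    exact h t a

/-- The intensity measure determines the joint law of the ordered distances. -/
theorem IsSCS.map_norm_eq [OpensMeasurableSpace E] (hX : IsSCS Λ P X) (hY : IsSCS Λ Q Y) :
    P.map (fun ω k => ‖X k ω‖) = Q.map (fun ω k => ‖Y k ω‖) := by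
  have mX : Measurable fun ω k => ‖X k ω‖ := measurable_pi_iff.2 fun k => (hX.measurable k).norm
  have mY : Measurable fun ω k => ‖Y k ω‖ := measurable_pi_iff.2 fun k => (hY.measurable k).norm
  have := Measure.isProbabilityMeasure_map (μ := P) mX.aemeasurable
  have := Measure.isProbabilityMeasure_map (μ := Q) mY.aemeasurable
  refine ext_of_forall_Iic fun t a => ?_
  let B : t → Set E := fun i => {x | ‖x‖ ≤ a i}
  have hB : ∀ i, MeasurableSet (B i) := fun i => measurableSet_le measurable_norm measurable_const
  -- With indices from `0`, the `i`-th distance is at most `a i` exactly when more than `i` points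
  -- lie in the ball of radius `a i`.
  let T : Set (t → ℕ∞) := {c | ∀ i : t, ((i : ℕ) : ℕ∞) < c i}
  have hT : MeasurableSet T := .of_discrete
  have ht : MeasurableSet {x : ℕ → ℝ | ∀ i ∈ t, x i ≤ a i} := by
    have : {x : ℕ → ℝ | ∀ i ∈ t, x i ≤ a i} = ⋂ i ∈ t, {x | x i ≤ a i} := by ext; simp
    rw [this]
    exact Finset.measurableSet_biInter _ fun i _ =>
      measurableSet_le (measurable_pi_apply i) measurable_const
  have h := congrArg (fun μ => μ T) (hX.map_counts_eq hY hB)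
  rw [Measure.map_apply (measurable_pi_iff.2 fun i => measurable_count hX.measurable (hB i)) hT,
    Measure.map_apply (measurable_pi_iff.2 fun i => measurable_count hY.measurable (hB i)) hT] at h
  rw [Measure.map_apply mX ht, Measure.map_apply mY ht]
  refine Eq.trans (measure_congr ?_) (h.trans (measure_congr ?_))
  · filter_upwards [hX.ordered] with ω hω
    refine propext (Iff.symm ?_)
    refine Subtype.forall.trans (forall₂_congr fun i _ => ?_)
    exact lt_count_iff_of_monotone hω i (a i)
  · filter_upwards [hY.ordered] with ω hω
    refine propext ?_
    refine Subtype.forall.trans (forall₂_congr fun i _ => ?_)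
    exact lt_count_iff_of_monotone hω i (a i)

theorem IsSCS.ae_notMem (hX : IsSCS Λ P X) {A : Set E} (hA : MeasurableSet A) (h : Λ A = 0) :
    ∀ᵐ ω ∂P, ∀ k, X k ω ∉ A := by
  have h0 := hX.poisson A hA (by simp [h]) 0
  rw [h, poissonMeasure_singleton] at h0
  have h1 : P {ω | count (fun k => X k ω) A = 0} = 1 := by simpa using h0
  have hm : MeasurableSet {ω | count (fun k => X k ω) A = 0} :=
    measurable_count hX.measurable hA (measurableSet_singleton 0)
  have h2 := (prob_compl_eq_zero_iff hm).2 h1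
  filter_upwards [compl_mem_ae_iff.2 h2] with ω hω k hk
  have : count (fun k => X k ω) A = 0 := by simpa using hω
  rw [count, Set.encard_eq_zero] at this
  exact Set.notMem_empty k (this ▸ hk)

omit [IsProbabilityMeasure P] in
-- The sequence always has infinitely many terms, whereas a Poisson count of finite mean vanishes
-- with positive probability.
theorem IsSCS.measure_univ (hX : IsSCS Λ P X) : Λ Set.univ = ∞ := by
  by_contra h
  have hc : ∀ ω, count (fun k => X k ω) Set.univ = ⊤ := fun ω => by
    simp [count, Set.encard_univ]
  have h0 := hX.poisson Set.univ .univ h 0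
  simp only [hc] at h0
  rw [poissonMeasure_singleton] at h0
  simp at h0
  exact absurd h0 (not_le.2 (Real.exp_pos _))

/-- Ordered points cannot accumulate in a ball whose complement is charged by the intensity, so
the intensity of such a ball is finite. -/
theorem IsSCS.measure_ne_top (hX : IsSCS Λ P X) [OpensMeasurableSpace E] {a : ℝ}
    (ha : Λ {x | a < ‖x‖} ≠ 0) : Λ {x | ‖x‖ ≤ a} ≠ ∞ := by
  intro h
  have hA : MeasurableSet {x : E | ‖x‖ ≤ a} := measurableSet_le measurable_norm measurable_const
  have hB : MeasurableSet {x : E | a < ‖x‖} := measurableSet_lt measurable_const measurable_norm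
  have key : ∀ᵐ ω ∂P, ∀ k, ‖X k ω‖ ≤ a := by
    filter_upwards [hX.infinite _ hA h, hX.ordered] with ω hω ho k
    rw [← lt_count_iff_of_monotone ho k a]
    exact (ENat.natCast_lt_top k).trans_eq hω.symm
  have hc : ∀ᵐ ω ∂P, count (fun k => X k ω) {x | a < ‖x‖} = 0 := by
    filter_upwards [key] with ω hω
    simpa [count, Set.eq_empty_iff_forall_notMem] using hω
  -- Almost surely no point lies outside the ball: infinite intensity there contradicts `infinite`,
  -- and finite intensity must be zero, since a Poisson variable that is a.s. zero has mean zero.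
  by_cases ht : Λ {x | a < ‖x‖} = ∞
  · obtain ⟨ω, h1, h2⟩ := (hc.and (hX.infinite _ hB ht)).exists
    simp [h1] at h2
  · have h0 := hX.poisson _ hB ht 0
    rw [poissonMeasure_singleton] at h0
    have h1 : P {ω | count (fun k => X k ω) {x | a < ‖x‖} = (0 : ℕ)} = 1 := by
      rw [measure_congr (Filter.eventuallyEq_univ.2 (by simp only [Nat.cast_zero]; exact hc)), MeasureTheory.measure_univ]
    rw [h1] at h0
    simp only [pow_zero, mul_one, Nat.factorial_zero, Nat.cast_one, div_one] at h0
    have h2 := ENNReal.ofReal_eq_one.1 h0.symm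
    rw [Real.exp_eq_one_iff, neg_eq_zero] at h2
    rcases (ENNReal.toReal_eq_zero_iff _).1 h2 with h3 | h3
    · exact ha h3
    · exact ht h3

omit [IsProbabilityMeasure P] in
/-- The mapping theorem, for maps that preserve the order of the distances. -/
theorem IsSCS.comp {F : Type*} [NormedAddCommGroup F] [MeasurableSpace F] (hX : IsSCS Λ P X)
    {Λ' : Measure F} {ψ : E → F} (hψ : Measurable ψ) (hΛ : Λ.map ψ = Λ')
    (ho : ∀ᵐ ω ∂P, Monotone fun k => ‖ψ (X k ω)‖) : IsSCS Λ' P fun k ω => ψ (X k ω) where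
  measurable k := hψ.comp (hX.measurable k)
  ordered := ho
  poisson A hA h n := by
    rw [← hΛ, Measure.map_apply hψ hA] at h ⊢
    exact hX.poisson _ (hψ hA) h n
  infinite A hA h := by
    rw [← hΛ, Measure.map_apply hψ hA] at h
    exact hX.infinite _ (hψ hA) h
  indep m A hA hd :=
    hX.indep m (fun i => ψ ⁻¹' A i) (fun i => hψ (hA i)) fun _ _ hij => (hd hij).preimage ψ

end Law

/-! ### Scale invariance and monotonicity of the ratio. -/

section Ratio

theorem carrierToInterference_norm {E : Type*} [NormedAddCommGroup E] (ε : ℝ) (x : ℕ → E) :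
    carrierToInterference ε (fun k => ‖x k‖) = carrierToInterference ε x := by
  simp [carrierToInterference]

theorem measurable_carrierToInterference (ε : ℝ) :
    Measurable fun x : ℕ → ℝ => carrierToInterference ε x := by
  unfold carrierToInterference
  refine Measurable.div ?_ (Measurable.tsum fun k => ?_)
  · exact (measurable_pi_apply 0).enorm.pow_const _
  · exact (measurable_pi_apply (k + 1)).enorm.pow_const _

/-- The ratio decreases if the relative distances `r k / r 0` decrease. -/
theorem carrierToInterference_le {ε : ℝ} (hε : 0 < ε) {r s : ℕ → ℝ} (hr : ∀ k, 0 < r k)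
    (hs : ∀ k, 0 < s k) (h : ∀ k, r k * s 0 ≤ r 0 * s k) :
    carrierToInterference ε r ≤ carrierToInterference ε s := by
  have ht : 0 < r 0 / s 0 := div_pos (hr 0) (hs 0)
  -- Rescaling `s` by `t` matches the first distances and leaves the ratio unchanged; afterwards
  -- only the interference terms differ.
  set t := r 0 / s 0 with ht_def
  have enorm_eq : ∀ {a : ℝ}, 0 < a → ‖a‖ₑ = ENNReal.ofReal a := fun ha =>
    Real.enorm_of_nonneg ha.le
  have hmul : ∀ k, (‖t‖ₑ * ‖s k‖ₑ) ^ (-ε) = ‖t‖ₑ ^ (-ε) * ‖s k‖ₑ ^ (-ε) := fun k =>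
    ENNReal.mul_rpow_of_ne_top enorm_ne_top enorm_ne_top _
  have h0 : ‖r 0‖ₑ ^ (-ε) = ‖t‖ₑ ^ (-ε) * ‖s 0‖ₑ ^ (-ε) := by
    rw [← hmul, ← enorm_mul, ht_def, div_mul_cancel₀ _ (hs 0).ne']
  have hle : ∀ k, ‖t‖ₑ ^ (-ε) * ‖s k‖ₑ ^ (-ε) ≤ ‖r k‖ₑ ^ (-ε) := by
    intro k
    rw [← hmul, ENNReal.rpow_neg, ENNReal.rpow_neg, ENNReal.inv_le_inv]
    refine ENNReal.rpow_le_rpow ?_ hε.le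
    rw [← enorm_mul, enorm_eq (hr k), enorm_eq (mul_pos ht (hs k))]
    refine ENNReal.ofReal_le_ofReal ?_
    rw [ht_def, div_mul_eq_mul_div, le_div_iff₀ (hs 0)]
    exact h k
  have ht0 : ‖t‖ₑ ≠ 0 := by simpa using ht.ne'
  have hT0 : ‖t‖ₑ ^ (-ε) ≠ 0 := (ENNReal.rpow_pos (pos_iff_ne_zero.2 ht0) enorm_ne_top).ne'
  have hT : ‖t‖ₑ ^ (-ε) ≠ ∞ := ENNReal.rpow_ne_top_of_ne_zero ht0 enorm_ne_top
  unfold carrierToInterference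
  calc ‖r 0‖ₑ ^ (-ε) / ∑' k : ℕ, ‖r (k + 1)‖ₑ ^ (-ε)
      ≤ ‖r 0‖ₑ ^ (-ε) / ∑' k : ℕ, ‖t‖ₑ ^ (-ε) * ‖s (k + 1)‖ₑ ^ (-ε) :=
        ENNReal.div_le_div_left (ENNReal.tsum_le_tsum fun k => hle (k + 1)) _
    _ = ‖s 0‖ₑ ^ (-ε) / ∑' k : ℕ, ‖s (k + 1)‖ₑ ^ (-ε) := by
        rw [ENNReal.tsum_mul_left, h0, ENNReal.mul_div_mul_left _ _ hT0 hT]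

theorem IsSCS.measure_lt_carrierToInterference_eq {E Ω Ω' : Type*} [NormedAddCommGroup E]
    [MeasurableSpace E] [OpensMeasurableSpace E] [MeasurableSpace Ω] [MeasurableSpace Ω']
    {Λ : Measure E} {P : Measure Ω} {Q : Measure Ω'}
    [IsProbabilityMeasure P] [IsProbabilityMeasure Q] {X : ℕ → Ω → E} {Y : ℕ → Ω' → E}
    (hX : IsSCS Λ P X) (hY : IsSCS Λ Q Y) (ε x : ℝ) :
    P {ω | (x : EReal) < (carrierToInterference ε (fun k => X k ω) : EReal)} =
      Q {ω | (x : EReal) < (carrierToInterference ε (fun k => Y k ω) : EReal)} := by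
  have hm : MeasurableSet {r : ℕ → ℝ | (x : EReal) < (carrierToInterference ε r : EReal)} :=
    measurableSet_lt measurable_const
      (measurable_coe_ennreal_ereal.comp (measurable_carrierToInterference ε))
  have h := congrArg (fun μ => μ {r | (x : EReal) < (carrierToInterference ε r : EReal)})
    (hX.map_norm_eq hY)
  rw [Measure.map_apply (measurable_pi_iff.2 fun k => (hX.measurable k).norm) hm,
    Measure.map_apply (measurable_pi_iff.2 fun k => (hY.measurable k).norm) hm] at h
  simpa only [Set.preimage_ofPred_eq, carrierToInterference_norm] using h

end Ratio

/-! ### Cumulated intensities of radial systems. -/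

section Radial

theorem radialIntensity_apply (f : ℝ → ℝ) {A : Set ℝ} (hA : MeasurableSet A) :
    radialIntensity f A = ∫⁻ r in A ∩ Set.Ioi 0, ENNReal.ofReal (f r) := by
  rw [radialIntensity, withDensity_apply _ hA, ← restrict_Ioi_eq_restrict_Ici,
    Measure.restrict_restrict hA]

theorem radialIntensity_Iic_of_nonpos (f : ℝ → ℝ) {a : ℝ} (ha : a ≤ 0) :
    radialIntensity f (Set.Iic a) = 0 := by
  have : Set.Iic a ∩ Set.Ioi 0 = ∅ := by
    rw [Set.Iic_inter_Ioi]; exact Set.Ioc_eq_empty (not_lt.2 ha)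
  rw [radialIntensity_apply f measurableSet_Iic, this]
  simp

theorem nullSingletonClass_radialIntensity (f : ℝ → ℝ) :
    NullSingletonClass (radialIntensity f) where
  measure_singleton x := by
    rw [radialIntensity_apply f (measurableSet_singleton x)]
    exact setLIntegral_measure_zero _ _ (measure_mono_null Set.inter_subset_left (by simp))

theorem homogeneousDensity_pos {l : ℕ} {lam0 : ℝ} (hb : 0 < b l) (h : 0 < lam0) {r : ℝ}
    (hr : 0 < r) : 0 < homogeneousDensity l lam0 r := by
  unfold homogeneousDensity; positivity

theorem radialIntensity_homogeneousDensity_Iic {l : ℕ} (hl : l ≠ 0) {lam0 : ℝ} (hb : 0 ≤ b l)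
    (h : 0 ≤ lam0) {a : ℝ} (ha : 0 ≤ a) :
    radialIntensity (homogeneousDensity l lam0) (Set.Iic a) =
      ENNReal.ofReal (lam0 * b l * a ^ l / l) := by
  rw [radialIntensity_apply _ measurableSet_Iic, Set.Iic_inter_Ioi]
  have hc : Continuous (homogeneousDensity l lam0) := by unfold homogeneousDensity; fun_prop
  rw [← ofReal_integral_eq_lintegral_ofReal (hc.integrableOn_Ioc)]
  · congr 1
    rw [← intervalIntegral.integral_of_le ha]
    unfold homogeneousDensity
    obtain ⟨n, rfl⟩ := Nat.exists_eq_succ_of_ne_zero hl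
    rw [intervalIntegral.integral_const_mul, Nat.succ_sub_one, integral_pow]
    push_cast
    rw [zero_pow (by omega), sub_zero, mul_div_assoc]
  · refine (ae_restrict_iff' measurableSet_Ioc).2 (.of_forall fun r hr => ?_)
    have := hr.1
    simp only [Pi.zero_apply, homogeneousDensity]
    positivity

theorem ext_of_Iic_of_ne_top {μ ν : Measure ℝ} (hfin : ∀ a, μ (Set.Iic a) ≠ ∞)
    (h : ∀ a, μ (Set.Iic a) = ν (Set.Iic a)) : μ = ν := by
  refine Measure.ext_of_generateFrom_of_iUnion (Set.range Set.Iic) (fun n : ℕ => Set.Iic (n : ℝ))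
    ?_ isPiSystem_Iic ?_ (fun n => ⟨n, rfl⟩) (fun n => hfin n) ?_
  · rw [BorelSpace.measurable_eq (α := ℝ), borel_eq_generateFrom_Iic]
  · exact Set.iUnion_eq_univ_iff.2 fun x => exists_nat_ge x
  · rintro _ ⟨a, rfl⟩
    exact h a

/-- Modulation by a non-increasing factor makes the ratio of the cumulated intensities
non-increasing. -/
theorem radialIntensity_antitone_mul_le {β f : ℝ → ℝ} (hf : ∀ r, 0 < r → 0 ≤ f r)
    (hβ : ∀ r, 0 < r → 0 < β r) (hmono : AntitoneOn β (Set.Ioi 0)) {s t : ℝ} (hs : 0 < s)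
    (hst : s ≤ t) :
    radialIntensity (fun r => β r * f r) (Set.Iic t) * radialIntensity f (Set.Iic s) ≤
      radialIntensity (fun r => β r * f r) (Set.Iic s) * radialIntensity f (Set.Iic t) := by
  have h1 : ENNReal.ofReal (β s) * radialIntensity f (Set.Iic s) ≤
      radialIntensity (fun r => β r * f r) (Set.Iic s) := by
    rw [radialIntensity_apply _ measurableSet_Iic, radialIntensity_apply _ measurableSet_Iic,
      ← lintegral_const_mul' _ _ ENNReal.ofReal_ne_top]
    refine setLIntegral_mono' (measurableSet_Iic.inter measurableSet_Ioi) fun r hr => ?_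
    rw [← ENNReal.ofReal_mul (hβ s hs).le]
    exact ENNReal.ofReal_le_ofReal (mul_le_mul_of_nonneg_right (hmono hr.2 hs hr.1) (hf r hr.2))
  have h2 : radialIntensity (fun r => β r * f r) (Set.Ioc s t) ≤
      ENNReal.ofReal (β s) * radialIntensity f (Set.Ioc s t) := by
    rw [radialIntensity_apply _ measurableSet_Ioc, radialIntensity_apply _ measurableSet_Ioc,
      ← lintegral_const_mul' _ _ ENNReal.ofReal_ne_top]
    refine setLIntegral_mono' (measurableSet_Ioc.inter measurableSet_Ioi) fun r hr => ?_
    rw [← ENNReal.ofReal_mul (hβ s hs).le]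
    exact ENNReal.ofReal_le_ofReal
      (mul_le_mul_of_nonneg_right (hmono hs hr.2 hr.1.1.le) (hf r hr.2))
  have split : ∀ μ : Measure ℝ, μ (Set.Iic t) = μ (Set.Iic s) + μ (Set.Ioc s t) := fun μ => by
    rw [← measure_union (Set.Iic_disjoint_Ioc le_rfl) measurableSet_Ioc,
      Set.Iic_union_Ioc_eq_Iic hst]
  rw [split, split (radialIntensity f), add_mul, mul_add]
  -- The product of the two masses of `Iic s` occurs on both sides. For the rest, `β s` bounds `β`
  -- from below before `s` and from above after `s`.
  refine add_le_add_right ?_ _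
  calc _ ≤ ENNReal.ofReal (β s) * radialIntensity f (Set.Ioc s t) * radialIntensity f (Set.Iic s) :=
        by gcongr
    _ = ENNReal.ofReal (β s) * radialIntensity f (Set.Iic s) * radialIntensity f (Set.Ioc s t) :=
        mul_right_comm _ _ _
    _ ≤ _ := by gcongr

/-- This is the antitone case for the factor `β⁻¹` applied to the density `β * f`, which restores
`f`. -/
theorem radialIntensity_monotone_mul_le {β f : ℝ → ℝ} (hf : ∀ r, 0 < r → 0 ≤ f r)
    (hβ : ∀ r, 0 < r → 0 < β r) (hmono : MonotoneOn β (Set.Ioi 0)) {s t : ℝ} (hs : 0 < s)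
    (hst : s ≤ t) :
    radialIntensity (fun r => β r * f r) (Set.Iic s) * radialIntensity f (Set.Iic t) ≤
      radialIntensity (fun r => β r * f r) (Set.Iic t) * radialIntensity f (Set.Iic s) := by
  have hinv : ∀ r, 0 < r → (β r)⁻¹ * (β r * f r) = f r := fun r hr =>
    inv_mul_cancel_left₀ (hβ r hr).ne' _
  have heq : ∀ {A : Set ℝ}, MeasurableSet A →
      radialIntensity (fun r => (β r)⁻¹ * (β r * f r)) A = radialIntensity f A := by
    intro A hA
    rw [radialIntensity_apply _ hA, radialIntensity_apply _ hA]
    exact setLIntegral_congr_fun (hA.inter measurableSet_Ioi) fun r hr => by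
      simp only [hinv r hr.2]
  have h := radialIntensity_antitone_mul_le (β := fun r => (β r)⁻¹) (f := fun r => β r * f r)
    (fun r hr => mul_nonneg (hβ r hr).le (hf r hr)) (fun r hr => inv_pos.2 (hβ r hr))
    (fun x hx y hy hxy => inv_anti₀ (hβ x hx) (hmono hx hy hxy)) hs hst
  rw [heq measurableSet_Iic, heq measurableSet_Iic] at h
  rwa [mul_comm, mul_comm (radialIntensity (fun r => β r * f r) _)]

theorem radialIntensity_Ioc_ne_zero {f : ℝ → ℝ} (hf : ∀ r, 0 < r → 0 < f r)
    (hm : AEMeasurable f (volume.restrict (Set.Ioi 0))) {s t : ℝ} (hs : 0 ≤ s) (hst : s < t) :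
    radialIntensity f (Set.Ioc s t) ≠ 0 := by
  have hsub : Set.Ioc s t ⊆ Set.Ioi 0 := fun x hx => hs.trans_lt hx.1
  rw [radialIntensity_apply _ measurableSet_Ioc, Set.inter_eq_left.2 hsub]
  intro h
  rw [lintegral_eq_zero_iff' (hm.mono_set hsub).ennreal_ofReal] at h
  have h' : ∀ᵐ r ∂volume.restrict (Set.Ioc s t), False := by
    filter_upwards [h, ae_restrict_mem measurableSet_Ioc] with r hr hr'
    exact not_le.2 (hf r (hsub hr')) (ENNReal.ofReal_eq_zero.1 hr)
  have h0 : volume (Set.Ioc s t) = 0 := 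
    Measure.restrict_eq_zero.1 (ae_eq_bot.1 (Filter.eventually_false_iff_eq_bot.1 h'))
  rw [Real.volume_Ioc, ENNReal.ofReal_eq_zero] at h0
  linarith

end Radial

/-! ### The monotone map between two cumulated intensities. -/

section Transport

variable {μ : Measure ℝ}

/-- An atomless measure on `[0, ∞)` of infinite mass, finite on bounded sets and of full support
takes every value on a unique initial interval. -/
theorem exists_forall_measureReal_Iic_le_iff [NullSingletonClass μ]
    (hfin : ∀ s, μ (Set.Iic s) ≠ ∞) (htop : μ Set.univ = ∞) (h0 : μ (Set.Iic 0) = 0)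
    (hpos : ∀ s t, 0 ≤ s → s < t → μ (Set.Ioc s t) ≠ 0) {y : ℝ} (hy : 0 ≤ y) :
    ∃ s, μ.real (Set.Iic s) = y ∧ ∀ t, μ.real (Set.Iic t) ≤ y ↔ t ≤ s := by
  have hsplit : ∀ s t : ℝ, s ≤ t →
      μ.real (Set.Iic t) = μ.real (Set.Iic s) + μ.real (Set.Ioc s t) := fun s t hst => by
    rw [← measureReal_union (Set.Iic_disjoint_Ioc le_rfl)
      measurableSet_Ioc (hfin s) (measure_ne_top_of_subset Set.Ioc_subset_Iic_self (hfin t)),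
      Set.Iic_union_Ioc_eq_Iic hst]
  have hr0 : μ.real (Set.Iic 0) = 0 := by simp [measureReal_def, h0]
  have hmono : Monotone fun s => μ.real (Set.Iic s) := fun s t hst =>
    measureReal_mono (Set.Iic_subset_Iic.2 hst) (hfin t)
  have hint : ∀ a c : ℝ, IntervalIntegrable (fun _ => (1 : ℝ)) μ a c := fun a c => by
    rw [intervalIntegrable_iff, Set.uIoc]
    exact integrableOn_const (measure_ne_top_of_subset Set.Ioc_subset_Iic_self (hfin _))
  -- The cumulated mass is the primitive of the constant `1`, continuous because `μ` has no atoms.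
  have hcont := intervalIntegral.continuous_primitive hint 0
  have hcont' : ContinuousOn (fun s => μ.real (Set.Iic s)) (Set.Ici 0) := by
    refine hcont.continuousOn.congr fun s hs => ?_
    simp only
    rw [intervalIntegral.integral_of_le hs, hsplit 0 s hs, hr0]
    simp
  obtain ⟨N, hN⟩ : ∃ N : ℝ, 0 ≤ N ∧ y < μ.real (Set.Iic N) := by
    have ht := tendsto_measure_Iic_atTop μ
    rw [htop] at ht
    obtain ⟨N, hN, hN0⟩ := ((ht.eventually (lt_mem_nhds (ENNReal.ofReal_lt_top (r := y)))).and
      (Filter.eventually_ge_atTop 0)).exists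
    exact ⟨N, hN0, (ENNReal.ofReal_lt_iff_lt_toReal hy (hfin N)).1 hN⟩
  obtain ⟨s, hs, hsy⟩ := intermediate_value_Icc hN.1 (hcont'.mono Set.Icc_subset_Ici_self)
    (show y ∈ Set.Icc _ _ from ⟨hr0.trans_le hy, hN.2.le⟩)
  refine ⟨s, hsy, fun t => ⟨fun h => ?_, fun h => (hmono h).trans_eq hsy⟩⟩
  by_contra! hst
  have h1 := hsplit s t hst.le
  have h2 : 0 < μ.real (Set.Ioc s t) := ENNReal.toReal_pos (hpos s t hs.1 hst)
    (measure_ne_top_of_subset Set.Ioc_subset_Iic_self (hfin t))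
  simp only at hsy
  linarith

/-- The map of distances that transports a measure `μ` on `[0, ∞)` to the one with cumulated
intensity `c * r ^ l`. -/
noncomputable def transport (μ : Measure ℝ) (c : ℝ) (l : ℕ) (s : ℝ) : ℝ :=
  (μ.real (Set.Iic s) / c) ^ (l : ℝ)⁻¹

theorem transport_nonneg {c : ℝ} (hc : 0 < c) (l : ℕ) (s : ℝ) : 0 ≤ transport μ c l s :=
  Real.rpow_nonneg (div_nonneg measureReal_nonneg hc.le) _

theorem mul_transport_pow {c : ℝ} (hc : 0 < c) {l : ℕ} (hl : l ≠ 0) (s : ℝ) :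
    c * transport μ c l s ^ l = μ.real (Set.Iic s) := by
  rw [transport, Real.rpow_inv_natCast_pow (div_nonneg measureReal_nonneg hc.le) hl,
    mul_div_cancel₀ _ hc.ne']

theorem monotone_transport (hfin : ∀ s, μ (Set.Iic s) ≠ ∞) {c : ℝ} (hc : 0 < c) (l : ℕ) :
    Monotone (transport μ c l) := fun s t hst =>
  Real.rpow_le_rpow (div_nonneg measureReal_nonneg hc.le)
    (div_le_div_of_nonneg_right (measureReal_mono (Set.Iic_subset_Iic.2 hst) (hfin t)) hc.le)
    (by positivity)

/-- Sublevel sets of the transport map are initial intervals, and the one at level `a ≥ 0` has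
`μ`-mass exactly `c * a ^ l`. Half-lines of finite mass determine the measure. -/
theorem map_transport [NullSingletonClass μ] (hfin : ∀ s, μ (Set.Iic s) ≠ ∞)
    (htop : μ Set.univ = ∞) (h0 : μ (Set.Iic 0) = 0)
    (hpos : ∀ s t, 0 ≤ s → s < t → μ (Set.Ioc s t) ≠ 0) {c : ℝ} (hc : 0 < c) {l : ℕ} (hl : l ≠ 0)
    {ν : Measure ℝ} (hν0 : ∀ a < 0, ν (Set.Iic a) = 0)
    (hν : ∀ a, 0 ≤ a → ν (Set.Iic a) = ENNReal.ofReal (c * a ^ l)) :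
    μ.map (transport μ c l) = ν := by
  have hm := (monotone_transport hfin hc l).measurable
  refine (ext_of_Iic_of_ne_top (fun a => ?_) fun a => ?_).symm
  · rcases lt_or_ge a 0 with ha | ha
    · simp [hν0 a ha]
    · simp [hν a ha]
  rw [Measure.map_apply hm measurableSet_Iic]
  rcases lt_or_ge a 0 with ha | ha
  · have : transport μ c l ⁻¹' Set.Iic a = ∅ :=
      Set.eq_empty_of_forall_notMem fun s hs => not_lt.2 (transport_nonneg hc l s) (hs.trans_lt ha)
    rw [hν0 a ha, this, measure_empty]
  · obtain ⟨s, hs, hiff⟩ := exists_forall_measureReal_Iic_le_iff hfin htop h0 hpos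
      (show 0 ≤ c * a ^ l by positivity)
    have : transport μ c l ⁻¹' Set.Iic a = Set.Iic s := by
      ext t
      rw [Set.mem_preimage, Set.mem_Iic, Set.mem_Iic, ← hiff, ← mul_transport_pow hc hl,
        mul_le_mul_iff_right₀ hc, pow_le_pow_iff_left₀ (transport_nonneg hc l t) ha hl]
    rw [hν a ha, this, ← hs, measureReal_def, ENNReal.ofReal_toReal (hfin s)]

end Transport

/-! ### The coupling and the effect of a monotone factor. -/

section Modulation

/-- The hypothesis compares `μ (Set.Iic r) / r ^ l` at `s` and `t`, that is, the `l`-th power of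
`transport μ c l r / r` up to the factor `c`; then take `l`-th roots. -/
theorem transport_mul_le {μ : Measure ℝ} (hfin : ∀ s, μ (Set.Iic s) ≠ ∞) {c : ℝ} (hc : 0 < c)
    {l : ℕ} (hl : l ≠ 0) {s t : ℝ} (hs : 0 < s) (ht : 0 < t)
    (h : μ (Set.Iic t) * ENNReal.ofReal (c * s ^ l) ≤ μ (Set.Iic s) * ENNReal.ofReal (c * t ^ l)) :
    transport μ c l t * s ≤ transport μ c l s * t := by
  have h' := ENNReal.toReal_mono (ENNReal.mul_ne_top (hfin s) ENNReal.ofReal_ne_top) h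
  rw [ENNReal.toReal_mul, ENNReal.toReal_mul, ENNReal.toReal_ofReal (by positivity),
    ENNReal.toReal_ofReal (by positivity), ← measureReal_def, ← measureReal_def,
    ← mul_transport_pow hc hl, ← mul_transport_pow hc hl, mul_mul_mul_comm,
    mul_mul_mul_comm c (transport μ c l s ^ l), mul_le_mul_iff_right₀ (mul_pos hc hc), ← mul_pow,
    ← mul_pow] at h'
  exact (pow_le_pow_iff_left₀ (mul_nonneg (transport_nonneg hc l t) hs.le)
    (mul_nonneg (transport_nonneg hc l s) ht.le) hl).1 h'

variable {Ω : Type*} [MeasurableSpace Ω] {P : Measure Ω} [IsProbabilityMeasure P]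
  {X : ℕ → Ω → ℝ}

/-- Local finiteness is not assumed of `f`, which may blow up at `0`. It follows from the existence
of ordered points, as a positive density charges the region beyond any `s`. -/
theorem IsSCS.radialIntensity_Iic_ne_top {f : ℝ → ℝ} (hX : IsSCS (radialIntensity f) P X)
    (hf : ∀ r, 0 < r → 0 < f r) (hm : AEMeasurable f (volume.restrict (Set.Ioi 0))) (s : ℝ) :
    radialIntensity f (Set.Iic s) ≠ ∞ := by
  rcases le_or_gt s 0 with hs | hs
  · simp [radialIntensity_Iic_of_nonpos f hs]
  have hne : radialIntensity f {x | s < ‖x‖} ≠ 0 := by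
    have h := radialIntensity_Ioc_ne_zero hf hm hs.le (lt_add_one s)
    refine fun h0 => h (measure_mono_null (fun x hx => ?_) h0)
    exact hx.1.trans_le (Real.le_norm_self x)
  have hsub : Set.Iic s ⊆ Set.Iic 0 ∪ {x | ‖x‖ ≤ s} := fun x hx => by
    rcases le_or_gt x 0 with h | h
    · exact Or.inl h
    · exact Or.inr ((Real.norm_of_nonneg h.le).trans_le hx)
  refine ne_top_of_le_ne_top ?_ ((measure_mono hsub).trans (measure_union_le _ _))
  rw [radialIntensity_Iic_of_nonpos f le_rfl, zero_add]
  exact hX.measure_ne_top hne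

theorem IsSCS.ae_pos {f : ℝ → ℝ} (hX : IsSCS (radialIntensity f) P X) :
    ∀ᵐ ω ∂P, ∀ k, 0 < X k ω := by
  filter_upwards [hX.ae_notMem measurableSet_Iic (radialIntensity_Iic_of_nonpos f le_rfl)]
    with ω hω k
  exact not_le.1 (hω k)

theorem transport_pos {μ : Measure ℝ} (hfin : ∀ s, μ (Set.Iic s) ≠ ∞)
    (hpos : ∀ s t, 0 ≤ s → s < t → μ (Set.Ioc s t) ≠ 0) {c : ℝ} (hc : 0 < c) {l : ℕ} (hl : l ≠ 0)
    {s : ℝ} (hs : 0 < s) : 0 < transport μ c l s := by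
  refine (transport_nonneg hc l s).lt_of_ne' fun h => ?_
  have h1 := mul_transport_pow (μ := μ) hc hl s
  rw [h, zero_pow hl, mul_zero] at h1
  refine hpos 0 s le_rfl hs (measure_mono_null Set.Ioc_subset_Iic_self ?_)
  exact ((ENNReal.toReal_eq_zero_iff _).1 h1.symm).resolve_right (hfin s)

theorem IsSCS.transport {f : ℝ → ℝ} (hX : IsSCS (radialIntensity f) P X)
    (hf : ∀ r, 0 < r → 0 < f r) (hm : AEMeasurable f (volume.restrict (Set.Ioi 0)))
    {l : ℕ} (hl : l ≠ 0) {lam0 : ℝ} (hb : 0 < b l) (h : 0 < lam0) :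
    IsSCS (radialIntensity (homogeneousDensity l lam0)) P
      fun k ω => transport (radialIntensity f) (lam0 * b l / l) l (X k ω) := by
  have hfin := hX.radialIntensity_Iic_ne_top hf hm
  have hc : 0 < lam0 * b l / l := by positivity
  have := nullSingletonClass_radialIntensity f
  refine hX.comp (monotone_transport hfin hc l).measurable
    (map_transport hfin hX.measure_univ (radialIntensity_Iic_of_nonpos f le_rfl)
      (fun s t hs hst => radialIntensity_Ioc_ne_zero hf hm hs hst) hc hl
      (fun a ha => radialIntensity_Iic_of_nonpos _ ha.le) fun a ha => ?_) ?_
  · rw [radialIntensity_homogeneousDensity_Iic hl hb.le h.le ha]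
    congr 1
    ring
  · filter_upwards [hX.ordered, hX.ae_pos] with ω ho hp i j hij
    have hij := ho hij
    simp only [Real.norm_of_nonneg (hp _).le] at hij
    simp only [Real.norm_of_nonneg (transport_nonneg hc l _)]
    exact monotone_transport hfin hc l hij

variable {ε lam0 : ℝ} {l : ℕ} {β : ℝ → ℝ}

theorem ciOrder_of_antitoneOn (hε : 0 < ε) (hl : l ≠ 0) (hb : 0 < b l) (h : 0 < lam0)
    (hβ : ∀ r, 0 < r → 0 < β r) (hmono : AntitoneOn β (Set.Ioi 0)) :
    CIOrder.{u, v} ε (radialIntensity (homogeneousDensity l lam0))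
      (radialIntensity fun r => β r * homogeneousDensity l lam0 r) := by
  intro Ω Ω' _ _ P Q _ _ X Y hX hY x
  have hpos : ∀ r, 0 < r → 0 < β r * homogeneousDensity l lam0 r := fun r hr =>
    mul_pos (hβ r hr) (homogeneousDensity_pos hb h hr)
  have hd : Continuous (homogeneousDensity l lam0) := by unfold homogeneousDensity; fun_prop
  have hm : AEMeasurable (fun r => β r * homogeneousDensity l lam0 r)
      (volume.restrict (Set.Ioi 0)) :=
    (aemeasurable_restrict_of_antitoneOn measurableSet_Ioi hmono).mul hd.aemeasurable
  have hfin := hY.radialIntensity_Iic_ne_top hpos hm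
  have hc : 0 < lam0 * b l / l := by positivity
  -- Uniqueness in law replaces `X` by the transported copy of `Y`, so both ratios live on one space
  -- and can be compared pointwise.
  rw [hX.measure_lt_carrierToInterference_eq (hY.transport hpos hm hl hb h)]
  refine measure_mono_ae ?_
  filter_upwards [hY.ordered, hY.ae_pos] with ω ho hp hω
  refine lt_of_lt_of_le hω (EReal.coe_ennreal_le_coe_ennreal_iff.2
    (carrierToInterference_le hε (fun k => transport_pos hfin
      (fun s t hs hst => radialIntensity_Ioc_ne_zero hpos hm hs hst) hc hl (hp k)) hp fun k => ?_))
  have h0k := ho (Nat.zero_le k)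
  simp only [Real.norm_of_nonneg (hp _).le] at h0k
  refine transport_mul_le hfin hc hl (hp 0) (hp k) ?_
  have := radialIntensity_antitone_mul_le (fun r hr => (homogeneousDensity_pos hb h hr).le) hβ
    hmono (hp 0) h0k
  rw [radialIntensity_homogeneousDensity_Iic hl hb.le h.le (hp 0).le,
    radialIntensity_homogeneousDensity_Iic hl hb.le h.le (hp k).le] at this
  rwa [div_mul_eq_mul_div, div_mul_eq_mul_div]

theorem ciOrder_of_monotoneOn (hε : 0 < ε) (hl : l ≠ 0) (hb : 0 < b l) (h : 0 < lam0)
    (hβ : ∀ r, 0 < r → 0 < β r) (hmono : MonotoneOn β (Set.Ioi 0)) :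
    CIOrder.{u, v} ε (radialIntensity fun r => β r * homogeneousDensity l lam0 r)
      (radialIntensity (homogeneousDensity l lam0)) := by
  intro Ω Ω' _ _ P Q _ _ X Y hX hY x
  have hpos : ∀ r, 0 < r → 0 < β r * homogeneousDensity l lam0 r := fun r hr =>
    mul_pos (hβ r hr) (homogeneousDensity_pos hb h hr)
  have hd : Continuous (homogeneousDensity l lam0) := by unfold homogeneousDensity; fun_prop
  have hm : AEMeasurable (fun r => β r * homogeneousDensity l lam0 r)
      (volume.restrict (Set.Ioi 0)) :=
    (aemeasurable_restrict_of_monotoneOn measurableSet_Ioi hmono).mul hd.aemeasurable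
  have hfin := hX.radialIntensity_Iic_ne_top hpos hm
  have hc : 0 < lam0 * b l / l := by positivity
  -- Here the modulated system is `X`; its transported copy replaces `Y` and has the larger relative
  -- distances.
  rw [hY.measure_lt_carrierToInterference_eq (hX.transport hpos hm hl hb h)]
  refine measure_mono_ae ?_
  filter_upwards [hX.ordered, hX.ae_pos] with ω ho hp hω
  refine lt_of_lt_of_le hω (EReal.coe_ennreal_le_coe_ennreal_iff.2
    (carrierToInterference_le hε hp (fun k => transport_pos hfin
      (fun s t hs hst => radialIntensity_Ioc_ne_zero hpos hm hs hst) hc hl (hp k)) fun k => ?_))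
  have h0k := ho (Nat.zero_le k)
  simp only [Real.norm_of_nonneg (hp _).le] at h0k
  rw [mul_comm, mul_comm (X 0 ω)]
  refine transport_mul_le hfin hc hl (hp k) (hp 0) ?_
  have := radialIntensity_monotone_mul_le (fun r hr => (homogeneousDensity_pos hb h hr).le) hβ
    hmono (hp 0) h0k
  rw [radialIntensity_homogeneousDensity_Iic hl hb.le h.le (hp 0).le,
    radialIntensity_homogeneousDensity_Iic hl hb.le h.le (hp k).le] at this
  rwa [div_mul_eq_mul_div, div_mul_eq_mul_div]

theorem radialIntensity_congr {f g : ℝ → ℝ} (h : ∀ r, 0 < r → f r = g r) :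
    radialIntensity f = radialIntensity g := by
  refine Measure.ext fun A hA => ?_
  rw [radialIntensity_apply f hA, radialIntensity_apply g hA]
  exact setLIntegral_congr_fun (hA.inter measurableSet_Ioi) fun r hr => by simp only [h r hr.2]

theorem ciOrder_homogeneousDensity_succ (hε : 0 < ε) (hl : l ≠ 0) (hb : 0 < b l)
    (hb' : 0 < b (l + 1)) (h : 0 < lam0) :
    CIOrder.{u, v} ε (radialIntensity (homogeneousDensity (l + 1) lam0))
      (radialIntensity (homogeneousDensity l lam0)) := by
  have heq : radialIntensity (homogeneousDensity l lam0) =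
      -- The quotient of the two densities is a positive multiple of `1 / r`, hence non-increasing.
      radialIntensity fun r => b l / b (l + 1) / r * homogeneousDensity (l + 1) lam0 r := by
    refine radialIntensity_congr fun r hr => ?_
    obtain ⟨n, rfl⟩ := Nat.exists_eq_succ_of_ne_zero hl
    simp only [homogeneousDensity, Nat.succ_eq_add_one, Nat.add_sub_cancel] at hb' ⊢
    field_simp
    exact (pow_succ r n).symm
  rw [heq]
  refine ciOrder_of_antitoneOn hε l.succ_ne_zero hb' h (fun r hr => by positivity) ?_
  intro r hr s _ hrs
  exact div_le_div_of_nonneg_left (by positivity) hr hrs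

end Modulation

/-! ### Reduction of homogeneous systems to radial ones. -/

section Homogeneous

theorem b_pos {l : ℕ} (hl : l ∈ ({1, 2, 3} : Set ℕ)) : 0 < b l := by
  have := Real.pi_pos
  rcases hl with rfl | rfl | rfl <;> simp [b] <;> positivity

theorem ne_zero_of_mem {l : ℕ} (hl : l ∈ ({1, 2, 3} : Set ℕ)) : l ≠ 0 := by
  rcases hl with rfl | rfl | rfl <;> decide

/-- Here `b l` is the surface measure of the unit sphere, so `b l / l` is the volume of the unit
ball. -/
theorem volume_closedBall_eq {l : ℕ} (hl : l ∈ ({1, 2, 3} : Set ℕ)) {a : ℝ} (ha : 0 ≤ a) :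
    volume (Metric.closedBall (0 : EuclideanSpace ℝ (Fin l)) a) =
      ENNReal.ofReal (b l * a ^ l / l) := by
  rcases hl with rfl | rfl | rfl
  · rw [EuclideanSpace.volume_closedBall, ← ENNReal.ofReal_pow ha,
      ← ENNReal.ofReal_mul (by positivity)]
    have : Real.Gamma (1 / 2 + 1) = √Real.pi / 2 := by
      rw [Real.Gamma_add_one (by norm_num), Real.Gamma_one_half_eq]; ring
    have hp : √Real.pi ≠ 0 := by positivity
    congr 1
    simp only [Fintype.card_fin, pow_one, Nat.cast_one, this, b, if_true]
    field_simp
  · rw [EuclideanSpace.volume_closedBall_fin_two, ← ENNReal.ofReal_pow ha,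
      ← ENNReal.ofReal_mul (by positivity)]
    congr 1
    norm_num [b]
    ring
  · rw [EuclideanSpace.volume_closedBall_fin_three, ← ENNReal.ofReal_pow ha,
      ← ENNReal.ofReal_mul (by positivity)]
    congr 1
    norm_num [b]
    ring

theorem map_norm_homogeneousIntensity {l : ℕ} (hl : l ∈ ({1, 2, 3} : Set ℕ)) {lam0 : ℝ}
    (h : 0 < lam0) :
    (homogeneousIntensity l lam0).map norm = radialIntensity (homogeneousDensity l lam0) := by
  have hpre : ∀ a : ℝ, norm ⁻¹' Set.Iic a = Metric.closedBall (0 : EuclideanSpace ℝ (Fin l)) a :=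
    fun a => by ext x; simp
  refine (ext_of_Iic_of_ne_top (fun a => ?_) fun a => ?_).symm
  · rcases le_or_gt a 0 with ha | ha
    · simp [radialIntensity_Iic_of_nonpos _ ha]
    · simp [radialIntensity_homogeneousDensity_Iic (ne_zero_of_mem hl) (b_pos hl).le h.le ha.le]
  rw [Measure.map_apply measurable_norm measurableSet_Iic, hpre, homogeneousIntensity,
    Measure.smul_apply, smul_eq_mul]
  rcases lt_or_ge a 0 with ha | ha
  · simp [radialIntensity_Iic_of_nonpos _ ha.le, Metric.closedBall_eq_empty.2 ha]
  · rw [radialIntensity_homogeneousDensity_Iic (ne_zero_of_mem hl) (b_pos hl).le h.le ha,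
      volume_closedBall_eq hl ha, ← ENNReal.ofReal_mul h.le]
    congr 1
    ring

theorem IsSCS.norm {Ω : Type*} [MeasurableSpace Ω] {P : Measure Ω} {l : ℕ}
    (hl : l ∈ ({1, 2, 3} : Set ℕ)) {lam0 : ℝ} (h : 0 < lam0)
    {X : ℕ → Ω → EuclideanSpace ℝ (Fin l)} (hX : IsSCS (homogeneousIntensity l lam0) P X) :
    IsSCS (radialIntensity (homogeneousDensity l lam0)) P fun k ω => ‖X k ω‖ :=
  hX.comp measurable_norm (map_norm_homogeneousIntensity hl h) (by simpa using hX.ordered)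

theorem CIOrder.homogeneous {ε lam0 : ℝ} (h : 0 < lam0) {l m : ℕ}
    (hl : l ∈ ({1, 2, 3} : Set ℕ)) (hm : m ∈ ({1, 2, 3} : Set ℕ))
    (hlm : CIOrder.{u, v} ε (radialIntensity (homogeneousDensity l lam0))
      (radialIntensity (homogeneousDensity m lam0))) :
    CIOrder.{u, v} ε (homogeneousIntensity l lam0) (homogeneousIntensity m lam0) := by
  intro Ω Ω' _ _ P Q _ _ X Y hX hY x
  have := hlm Ω Ω' P Q _ _ (hX.norm hl h) (hY.norm hm h) x
  simpa only [carrierToInterference_norm] using this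

end Homogeneous

end Shotgun

theorem mainTheorem6 (ε lam0 : ℝ) (hε : 0 < ε) (hlam0 : 0 < lam0) :
    -- `lam0 * b_l * r ^ (l - 1)` is the equivalent 1-D density of the homogeneous `l`-D system
    (∀ l ∈ ({1, 2, 3} : Set ℕ), ∀ (Ω : Type u) [MeasurableSpace Ω] (P : Measure Ω)
      [IsProbabilityMeasure P] (X : ℕ → Ω → EuclideanSpace ℝ (Fin l)),
      Shotgun.IsSCS (Shotgun.homogeneousIntensity l lam0) P X →
        Shotgun.IsSCS (Shotgun.radialIntensity (Shotgun.homogeneousDensity l lam0)) P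
          (fun k ω => ‖X k ω‖)) ∧
    -- a non-increasing factor improves the ratio
    (∀ l ∈ ({1, 2, 3} : Set ℕ), ∀ β : ℝ → ℝ, (∀ r, 0 < r → 0 < β r) →
      AntitoneOn β (Set.Ioi 0) →
        Shotgun.CIOrder.{u, v} ε
          (Shotgun.radialIntensity (Shotgun.homogeneousDensity l lam0))
          (Shotgun.radialIntensity fun r => β r * Shotgun.homogeneousDensity l lam0 r)) ∧
    -- a non-decreasing factor worsens the ratio
    (∀ l ∈ ({1, 2, 3} : Set ℕ), ∀ β : ℝ → ℝ, (∀ r, 0 < r → 0 < β r) →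
      MonotoneOn β (Set.Ioi 0) →
        Shotgun.CIOrder.{u, v} ε
          (Shotgun.radialIntensity fun r => β r * Shotgun.homogeneousDensity l lam0 r)
          (Shotgun.radialIntensity (Shotgun.homogeneousDensity l lam0))) ∧
    -- the ratio degrades from dimension 1 to 2 to 3: equivalent 1-D systems
    (Shotgun.CIOrder.{u, v} ε
        (Shotgun.radialIntensity (Shotgun.homogeneousDensity 2 lam0))
        (Shotgun.radialIntensity (Shotgun.homogeneousDensity 1 lam0)) ∧
      Shotgun.CIOrder.{u, v} ε
        (Shotgun.radialIntensity (Shotgun.homogeneousDensity 3 lam0))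
        (Shotgun.radialIntensity (Shotgun.homogeneousDensity 2 lam0))) ∧
    -- the ratio degrades from dimension 1 to 2 to 3: homogeneous systems in `ℝ^l`
    (Shotgun.CIOrder.{u, v} ε
        (Shotgun.homogeneousIntensity 2 lam0) (Shotgun.homogeneousIntensity 1 lam0) ∧
      Shotgun.CIOrder.{u, v} ε
        (Shotgun.homogeneousIntensity 3 lam0) (Shotgun.homogeneousIntensity 2 lam0)) := by
  have h1 : 1 ∈ ({1, 2, 3} : Set ℕ) := by simp
  have h2 : 2 ∈ ({1, 2, 3} : Set ℕ) := by simp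
  have h3 : 3 ∈ ({1, 2, 3} : Set ℕ) := by simp
  have h21 := Shotgun.ciOrder_homogeneousDensity_succ.{u, v} hε one_ne_zero (Shotgun.b_pos h1)
    (Shotgun.b_pos h2) hlam0
  have h32 := Shotgun.ciOrder_homogeneousDensity_succ.{u, v} hε two_ne_zero (Shotgun.b_pos h2)
    (Shotgun.b_pos h3) hlam0
  exact ⟨fun l hl Ω _ P _ X hX => hX.norm hl hlam0,
    fun l hl β hβ hmono => Shotgun.ciOrder_of_antitoneOn hε (Shotgun.ne_zero_of_mem hl)
      (Shotgun.b_pos hl) hlam0 hβ hmono,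
    fun l hl β hβ hmono => Shotgun.ciOrder_of_monotoneOn hε (Shotgun.ne_zero_of_mem hl)
      (Shotgun.b_pos hl) hlam0 hβ hmono,
    ⟨h21, h32⟩, h21.homogeneous hlam0 h2 h1, h32.homogeneous hlam0 h3 h2⟩
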